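/- Let $k$ be a field, let $A = k[x_1,\dots,x_r]$ be a standard graded polynomial ring, and let $\mathfrak m = (x_1,\dots,x_r)$, so that $k = A/\mathfrak m$ as an $A$-module. Let $I$ be a nonzero proper ideal of $A$. For $n \ge 0$ let $$I^{(n)} := A \cap \bigcap_{P \in \mathrm{Min}(I)} I^n A_P$$ be the $n$-th symbolic power of $I$, where $\mathrm{Min}(I)$ is the set of minimal primes of $I$ and $A \cap (-)$ denotes contraction to $A$. In particular, $I^{(0)} = A$. A *filtration* is a sequence of ideals $P_0 \supseteq P_1 \supseteq \cdots$ of $A$ such that $P_0 = A$ and $P_1$ is nonzero and proper. It is *Tor-vanishing* if the map $\mathrm{Tor}_i^A(k,P_n) \to \mathrm{Tor}_i^A(k,P_{n-1})$ induced by the inclusion $P_n \subseteq P_{n-1}$ is zero for all $i \ge 0$ and all $n \ge 1$. 1. Suppose that $\operatorname{char} k = 0$ and that $I$ is homogeneous. Then $\partial(I^{(n)}) \subseteq I^{(n-1)}$ for all $n \ge 1$: for every set $S$ of generators of $I^{(n)}$, the ideal generated by the partial derivatives $\partial f/\partial x_j$ with $f \in S$ and $1 \le j \le r$ is contained in $I^{(n-1)}$.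 Moreover, $\{I^{(n)}\}_{n \ge 0}$ is a Tor-vanishing filtration. 2. Suppose that $I$ is a monomial ideal, with $k$ of arbitrary characteristic. For a monomial ideal $Q$, let $\partial^*(Q)$ be the ideal generated by the monomials $f/x_j$, where $f$ is a minimal monomial generator of $Q$ and $x_j$ is a variable dividing $f$. Then $\partial^*(I^{(n)}) \subseteq I^{(n-1)}$ for all $n \ge 1$. Moreover, $\{I^{(n)}\}_{n \ge 0}$ is a Tor-vanishing filtration. -/

import Mathlib

noncomputable section

open MvPolynomial

/-- The `n`-th symbolic power `Q^(n) = R ∩ ⋂_{P ∈ Min(Q)} Qⁿ R_P`: the intersection, over the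
minimal primes `P` of `Q`, of the contractions to `R` of the extensions of `Qⁿ` to the
localizations `R_P`. For `n = 0` this is the whole ring. -/
def symbolicPower {R : Type*} [CommRing R] (Q : Ideal R) (n : ℕ) : Ideal R :=
  ⨅ P : Q.minimalPrimes,
    haveI : (P : Ideal R).IsPrime := P.2.1.1
    ((Q ^ n).map (algebraMap R (Localization.AtPrime (P : Ideal R)))).comap
      (algebraMap R (Localization.AtPrime (P : Ideal R)))

/-- The ideal generated by all first order partial derivatives of the elements of a set `S` of
polynomials. If `S` is a set of generators of the ideal `Q`, this is `∂(Q)`. -/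
def partialIdeal {k : Type*} [Field k] {r : ℕ} (S : Set (MvPolynomial (Fin r) k)) :
    Ideal (MvPolynomial (Fin r) k) :=
  Ideal.span {g | ∃ f ∈ S, ∃ i : Fin r, g = pderiv i f}

/-- A monomial ideal: an ideal generated by a set of monomials (given by their exponents). -/
def IsMonomialIdeal {k : Type*} [Field k] {r : ℕ} (Q : Ideal (MvPolynomial (Fin r) k)) : Prop :=
  ∃ E : Set (Fin r →₀ ℕ), Q = Ideal.span ((fun e => monomial e (1 : k)) '' E)

/-- `x^d` is a minimal monomial generator of the (monomial) ideal `Q`: it lies in `Q`, and no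
proper monomial divisor of it lies in `Q`. -/
def IsMinimalMonomialGenerator {k : Type*} [Field k] {r : ℕ}
    (Q : Ideal (MvPolynomial (Fin r) k)) (d : Fin r →₀ ℕ) : Prop :=
  Minimal (fun e : Fin r →₀ ℕ => monomial e (1 : k) ∈ Q) d

/-- `∂*(Q)`: the ideal generated by the monomials `f / x`, where `f = x^d` is a minimal monomial
generator of `Q` and `x = x_i` is a variable dividing `f`. -/
def partialStarIdeal {k : Type*} [Field k] {r : ℕ} (Q : Ideal (MvPolynomial (Fin r) k)) :
    Ideal (MvPolynomial (Fin r) k) :=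
  Ideal.span {g | ∃ d : Fin r →₀ ℕ, IsMinimalMonomialGenerator Q d ∧
    ∃ i ∈ d.support, g = monomial (d - Finsupp.single i 1) (1 : k)}

/-- The field `k` as a module over `A = k[x_1, …, x_r]`, namely `A / (x_1, …, x_r)`. -/
abbrev residueModule (k : Type*) [Field k] (r : ℕ) : ModuleCat (MvPolynomial (Fin r) k) :=
  ModuleCat.of (MvPolynomial (Fin r) k)
    (MvPolynomial (Fin r) k ⧸
      Ideal.span (Set.range (X : Fin r → MvPolynomial (Fin r) k)))

/-- For ideals `Q ⊆ Q'` of `A = k[x_1, …, x_r]`, the inclusion `Q → Q'` is Tor-vanishing: the map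
`Tor_i^A(k, Q) → Tor_i^A(k, Q')` that it induces is zero for all `i ≥ 0`. -/
def IsTorVanishingInclusion {k : Type*} [Field k] {r : ℕ}
    {Q Q' : Ideal (MvPolynomial (Fin r) k)} (h : Q ≤ Q') : Prop :=
  ∀ i : ℕ,
    ((CategoryTheory.Tor (ModuleCat (MvPolynomial (Fin r) k)) i).obj (residueModule k r)).map
      (ModuleCat.ofHom (Submodule.inclusion h)) = 0

/-- A filtration of ideals: a descending sequence of ideals `P_0 ⊇ P_1 ⊇ ⋯` with `P_0 = R` and
`P_1` nonzero and proper. -/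
structure IsIdealFiltration {R : Type*} [CommRing R] (P : ℕ → Ideal R) : Prop where
  zero_eq : P 0 = ⊤
  one_ne_bot : P 1 ≠ ⊥
  one_ne_top : P 1 ≠ ⊤
  succ_le : ∀ n, P (n + 1) ≤ P n

/-- A filtration `(P_n)` of ideals in `k[x_1, …, x_r]` is Tor-vanishing if all the inclusions
`P_{n+1} → P_n` are Tor-vanishing. -/
structure IsTorVanishingFiltration {k : Type*} [Field k] {r : ℕ}
    (P : ℕ → Ideal (MvPolynomial (Fin r) k)) : Prop extends IsIdealFiltration P where
  torVanishing : ∀ n, IsTorVanishingInclusion (succ_le n)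

end

/-! Tor vanishing is reduced to Koszul complexes: `Q ≤ Q'` is Tor-vanishing as soon as every Koszul
cycle on the variables with entries in `Q` is the boundary of a chain with entries in `Q'`. Such
chains come from operators `D` with `D Q ⊆ Q'`: the Koszul differential and `e_j ∧ D` satisfy a
homotopy formula (`koszulD_koszulExt_add`) whose error term is the commutator of `D` with the
variables.

In characteristic zero take all `∂/∂x_j` at once. The exterior derivative and the Koszul
differential have as anticommutator the scalar polynomial degree plus exterior degree (Cartan's
formula), invertible away from the constants in exterior degree zero; these are absent because `Q`
is proper. For monomial ideals take division by `x_j`, which clears a cycle of one variable after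
another.

For symbolic powers, a derivation maps `I^(n+1)` into `I^(n)` by Leibniz and the quotient rule.
Homogeneity of `I^(n)` follows from stability under the Euler derivation, with no analysis of the
minimal primes. In the monomial case, witnesses outside a minimal prime can be chosen to be
monomials (`IsMonomialIdeal.exists_monomial_mul_mem`), and then division by a variable behaves like
a derivation on powers of `I`.

The passage to Tor (`tor_map_eq_zero_of_koszul`) carries the Koszul condition up a projective
resolution by dimension shifting, so Tor need not be identified with Koszul homology. -/

noncomputable section

open MvPolynomial

/-! ### Exterior algebra with coefficients and the Koszul differential -/

section Koszul

variable {ι M N : Type*} [LinearOrder ι] [AddCommGroup M] [AddCommGroup N]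

/-- The sign relating `e_j ∧ e_S` and `e_{insert j S}`. -/
def koszulSign (j : ι) (S : Finset ι) : ℤ := (-1) ^ (S.filter (· < j)).card

lemma koszulSign_mul_self (j : ι) (S : Finset ι) : koszulSign j S * koszulSign j S = 1 := by
  rw [koszulSign, ← mul_pow]; simp

lemma koszulSign_insert_of_lt {j l : ι} {S : Finset ι} (hl : l ∉ S) (h : l < j) :
    koszulSign j (insert l S) = -koszulSign j S := by
  rw [koszulSign, koszulSign, Finset.filter_insert, if_pos h, Finset.card_insert_of_notMem (by simp [hl])]
  ring

lemma koszulSign_insert_of_gt {j l : ι} {S : Finset ι} (h : j < l) :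
    koszulSign j (insert l S) = koszulSign j S := by
  rw [koszulSign, koszulSign, Finset.filter_insert, if_neg h.not_gt]

lemma koszulSign_anticomm {j l : ι} (h : j ≠ l) {S : Finset ι} (hj : j ∉ S) (hl : l ∉ S) :
    koszulSign j (insert l S) * koszulSign l S = -(koszulSign l (insert j S) * koszulSign j S) := by
  rcases lt_or_gt_of_ne h with h | h
  · rw [koszulSign_insert_of_gt h, koszulSign_insert_of_lt hj h]; ring
  · rw [koszulSign_insert_of_lt hl h, koszulSign_insert_of_gt h]; ring

/-- Contraction with the `j`-th basis covector. A function `z : Finset ι → M` stands for the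
element `∑ e_S ⊗ z S` of `Λ ⊗ M`, where `Λ` is the exterior algebra on the `e_j`, `j : ι`. -/
def koszulInt (j : ι) : (Finset ι → M) →+ (Finset ι → M) where
  toFun z S := if j ∈ S then 0 else koszulSign j S • z (insert j S)
  map_zero' := by ext; simp
  map_add' := by intro a b; ext S; by_cases h : j ∈ S <;> simp [h]

/-- Exterior multiplication with `e_j`. -/
def koszulExt (j : ι) : (Finset ι → M) →+ (Finset ι → M) where
  toFun z S := if j ∈ S then koszulSign j (S.erase j) • z (S.erase j) else 0
  map_zero' := by ext; simp
  map_add' := by intro a b; ext S; by_cases h : j ∈ S <;> simp [h]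

lemma koszulInt_apply (j : ι) (z : Finset ι → M) (S : Finset ι) :
    koszulInt j z S = if j ∈ S then 0 else koszulSign j S • z (insert j S) := rfl

lemma koszulExt_apply (j : ι) (z : Finset ι → M) (S : Finset ι) :
    koszulExt j z S = if j ∈ S then koszulSign j (S.erase j) • z (S.erase j) else 0 := rfl

lemma koszulInt_comp (f : M →+ N) (j : ι) (z : Finset ι → M) :
    koszulInt j (fun S => f (z S)) = fun S => f (koszulInt j z S) := by
  ext S; by_cases h : j ∈ S <;> simp [koszulInt_apply, h]

lemma koszulInt_smul {R : Type*} [Ring R] [Module R M] (c : R) (j : ι) (z : Finset ι → M) :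
    koszulInt j (c • z) = c • koszulInt j z :=
  koszulInt_comp (DistribSMul.toAddMonoidHom M c) j z

lemma koszulExt_smul {R : Type*} [Ring R] [Module R M] (c : R) (j : ι) (z : Finset ι → M) :
    koszulExt j (c • z) = c • koszulExt j z := by
  ext S; by_cases h : j ∈ S <;> simp [koszulExt_apply, h, smul_comm c]

lemma koszulInt_koszulInt_self (j : ι) (z : Finset ι → M) : koszulInt j (koszulInt j z) = 0 := by
  ext S; by_cases h : j ∈ S <;> simp [koszulInt_apply, h]

lemma koszulInt_anticomm {j l : ι} (h : j ≠ l) (z : Finset ι → M) :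
    koszulInt j (koszulInt l z) = -koszulInt l (koszulInt j z) := by
  ext S
  by_cases hj : j ∈ S <;> by_cases hl : l ∈ S <;>
    simp only [koszulInt_apply, hj, hl, h, h.symm, Pi.neg_apply, Finset.mem_insert, if_true,
      if_false, or_true, or_false, smul_zero, neg_zero]
  rw [Finset.insert_comm, smul_smul, smul_smul, ← neg_smul, mul_comm, koszulSign_anticomm h.symm hl hj,
    mul_comm (koszulSign l S)]

lemma koszulInt_koszulExt_self (j : ι) (z : Finset ι → M) :
    koszulInt j (koszulExt j z) = z - koszulExt j (koszulInt j z) := by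
  ext S
  by_cases hj : j ∈ S
  · simp [koszulInt_apply, koszulExt_apply, hj, smul_smul, koszulSign_mul_self]
  · simp [koszulInt_apply, koszulExt_apply, hj, smul_smul, koszulSign_mul_self]

lemma koszulInt_koszulExt_of_ne {j l : ι} (h : l ≠ j) (z : Finset ι → M) :
    koszulInt l (koszulExt j z) = -koszulExt j (koszulInt l z) := by
  ext S
  by_cases hl : l ∈ S <;> by_cases hj : j ∈ S <;>
    simp only [koszulInt_apply, koszulExt_apply, hj, hl, h, h.symm, Pi.neg_apply,
      Finset.mem_insert, Finset.mem_erase, ne_eq, not_false_eq_true, and_true,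
      if_true, if_false, or_true, or_false, smul_zero, neg_zero]
  obtain ⟨T, hT, rfl⟩ : ∃ T, j ∉ T ∧ insert j T = S :=
    ⟨S.erase j, by simp, Finset.insert_erase hj⟩
  rw [Finset.insert_comm l j, Finset.erase_insert hT,
    Finset.erase_insert (by simp [hT, h.symm])]
  have hl' : l ∉ T := fun h' => hl (Finset.mem_insert_of_mem h')
  simp only [and_false, if_false]
  rw [smul_smul, smul_smul, ← neg_smul]
  congr 1
  linear_combination
    koszulSign j T * koszulSign j (insert l T) * koszulSign_anticomm h hl' hT
      - koszulSign l (insert j T) * koszulSign j (insert l T) * koszulSign_mul_self j T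
      - koszulSign j T * koszulSign l T * koszulSign_mul_self j (insert l T)

lemma koszulExt_koszulInt_self_apply (j : ι) (z : Finset ι → M) (S : Finset ι) :
    koszulExt j (koszulInt j z) S = if j ∈ S then z S else 0 := by
  by_cases hj : j ∈ S
  · simp [koszulInt_apply, koszulExt_apply, hj, smul_smul, koszulSign_mul_self]
  · simp [koszulExt_apply, hj]

variable [Fintype ι] {R : Type*} [CommRing R] [Module R M] [Module R N] (x : ι → R)

/-- The Koszul differential of the sequence `x` on `Λ ⊗ M`. -/
def koszulD : (Finset ι → M) →+ (Finset ι → M) where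
  toFun z := ∑ l, x l • koszulInt l z
  map_zero' := by simp
  map_add' := by intro a b; simp [Finset.sum_add_distrib]

lemma koszulD_eq (z : Finset ι → M) : koszulD x z = ∑ l, x l • koszulInt l z := rfl

lemma koszulD_apply (z : Finset ι → M) (S : Finset ι) :
    koszulD x z S = ∑ l, x l • koszulInt l z S := by
  simp [koszulD_eq]

lemma koszulD_apply_empty (z : Finset ι → M) : koszulD x z ∅ = ∑ l, x l • z {l} := by
  simp [koszulD_apply, koszulInt_apply, koszulSign]

lemma koszulD_comp (f : M →ₗ[R] N) (z : Finset ι → M) :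
    koszulD x (fun S => f (z S)) = fun S => f (koszulD x z S) := by
  ext S
  rw [koszulD_apply, koszulD_apply, map_sum]
  refine Finset.sum_congr rfl fun l _ => ?_
  rw [map_smul]
  exact congrArg _ (congrFun (koszulInt_comp f.toAddMonoidHom l z) S)

/-- Induction on the set of variables in play: adjoining `a` adds a square, which is zero, and cross
terms that cancel in pairs by anticommutation. -/
lemma koszulD_koszulD (z : Finset ι → M) : koszulD x (koszulD x z) = 0 := by
  suffices ∀ T : Finset ι,
      ∑ l ∈ T, x l • koszulInt l (∑ j ∈ T, x j • koszulInt j z) = 0 from this Finset.univ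
  intro T
  induction T using Finset.induction_on with
  | empty => simp
  | insert a T ha ih =>
    rw [Finset.sum_insert ha, Finset.sum_insert ha]
    simp only [map_add, smul_add, Finset.sum_add_distrib, ih, koszulInt_smul,
      koszulInt_koszulInt_self, smul_zero, zero_add, add_zero]
    rw [map_sum, Finset.smul_sum, ← Finset.sum_add_distrib]
    refine Finset.sum_eq_zero fun l hl => ?_
    rw [koszulInt_smul, koszulInt_anticomm (by rintro rfl; exact ha hl : a ≠ l), smul_neg, smul_neg,
      smul_comm (x a), neg_add_cancel]

/-- The homotopy formula for the operator `e_j ∧ D`, where `D` is any additive operator. -/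
lemma koszulD_koszulExt_add (D : M →+ M) (j : ι) (z : Finset ι → M) :
    koszulD x (koszulExt j fun S => D (z S)) + koszulExt j (fun S => D (koszulD x z S)) =
      x j • (fun S => D (z S)) +
        koszulExt j (∑ l, koszulInt l fun S => D (x l • z S) - x l • D (z S)) := by
  have h1 : (fun S => D (koszulD x z S)) = ∑ l, koszulInt l fun S => D (x l • z S) := by
    ext S
    rw [koszulD_apply, map_sum, Finset.sum_apply]
    refine Finset.sum_congr rfl fun l _ => ?_
    exact (congrFun (koszulInt_comp (D.comp (DistribSMul.toAddMonoidHom M (x l))) l z) S).symm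
  -- The Clifford relation `ι_l e_j + e_j ι_l = δ_{lj}`.
  have h2 : ∀ l, koszulInt l (koszulExt j fun S => D (z S)) =
      (if l = j then fun S => D (z S) else 0) - koszulExt j (koszulInt l fun S => D (z S)) := by
    intro l
    by_cases h : l = j
    · subst h; rw [koszulInt_koszulExt_self, if_pos rfl]
    · rw [koszulInt_koszulExt_of_ne h, if_neg h, zero_sub]
  rw [h1, koszulD_eq]
  simp only [h2, smul_sub, Finset.sum_sub_distrib, smul_ite, smul_zero, Finset.sum_ite_eq',
    Finset.mem_univ, if_true]
  rw [sub_add, sub_eq_add_neg]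
  congr 1
  rw [neg_sub]
  have h3 : ∀ l, (koszulInt l fun S => D (x l • z S) - x l • D (z S)) =
      (koszulInt l fun S => D (x l • z S)) - x l • koszulInt l fun S => D (z S) := by
    intro l
    rw [← koszulInt_smul, ← map_sub]
    rfl
  simp only [h3, Finset.sum_sub_distrib, map_sub, map_sum, koszulExt_smul]

end Koszul

/-! ### Koszul acyclicity passes to projective modules -/

section Acyclic

variable {ι M N R : Type*} [LinearOrder ι] [Fintype ι] [CommRing R] [AddCommGroup M]
  [AddCommGroup N] [Module R M] [Module R N]

/-- The Koszul complex of `x` on `M` is exact in positive exterior degrees. -/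
def KoszulAcyclic (x : ι → R) (M : Type*) [AddCommGroup M] [Module R M] : Prop :=
  ∀ z : Finset ι → M, z ∅ = 0 → koszulD x z = 0 → ∃ w, koszulD x w = z

lemma KoszulAcyclic.of_retract {x : ι → R} (h : KoszulAcyclic x N) (i : M →ₗ[R] N)
    (p : N →ₗ[R] M) (hp : ∀ m, p (i m) = m) : KoszulAcyclic x M := by
  intro z h0 hz
  obtain ⟨w, hw⟩ := h (fun S => i (z S)) (by simp [h0]) (by
    rw [koszulD_comp, hz]; ext; simp)
  refine ⟨fun S => p (w S), ?_⟩
  rw [koszulD_comp, hw]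
  simp [hp]

lemma KoszulAcyclic.finsupp {x : ι → R} (h : KoszulAcyclic x R) (κ : Type*) :
    KoszulAcyclic x (κ →₀ R) := by
  classical
  intro z h0 hz
  have hc : ∀ c : κ, ∃ w, koszulD x w = fun S => z S c := by
    intro c
    refine h _ (by simp [h0]) ?_
    rw [show (fun S => z S c) = fun S => Finsupp.lapply (R := R) c (z S) from rfl, koszulD_comp, hz]
    ext; simp
  choose w hw using hc
  -- A chain has finitely many entries, so only finitely many coordinates occur and the
  -- coordinatewise primitives can be summed.
  set T : Finset κ := Finset.univ.biUnion fun S => (z S).support with hT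
  refine ⟨∑ c ∈ T, fun S => Finsupp.lsingle (R := R) c (w c S), ?_⟩
  rw [map_sum]
  simp only [koszulD_comp, hw]
  ext S c
  simp only [Finset.sum_apply, Finsupp.lsingle_apply, Finsupp.finsetSum_apply,
    Finsupp.single_apply, Finset.sum_ite_eq']
  split_ifs with h
  · rfl
  · by_contra h'
    exact h (Finset.mem_biUnion.mpr ⟨S, Finset.mem_univ _, by simpa using Ne.symm h'⟩)

lemma KoszulAcyclic.of_projective {x : ι → R} (h : KoszulAcyclic x R) [Module.Projective R M] :
    KoszulAcyclic x M := by
  obtain ⟨s, hs⟩ := Module.Projective.out (R := R) (P := M)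
  exact (h.finsupp M).of_retract s _ hs

end Acyclic

/-! ### Division by a variable as a Koszul homotopy -/

section Monomial

variable {ι k : Type*} [CommRing k]

/-- Division by the variable `X j`, as an additive map. -/
def divX (j : ι) : MvPolynomial ι k →+ MvPolynomial ι k where
  toFun f := divMonomial f (Finsupp.single j 1)
  map_zero' := zero_divMonomial _
  map_add' f g := add_divMonomial f g _

lemma divX_apply (j : ι) (f : MvPolynomial ι k) :
    divX j f = divMonomial f (Finsupp.single j 1) := rfl

lemma coeff_divX (j : ι) (f : MvPolynomial ι k) (a : ι →₀ ℕ) :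
    coeff a (divX j f) = coeff (Finsupp.single j 1 + a) f := by
  rw [divX_apply, coeff_divMonomial]

lemma divX_X_mul_sub [DecidableEq ι] (j l : ι) (f : MvPolynomial ι k) :
    divX j (X l * f) - X l * divX j f =
      if l = j then modMonomial f (Finsupp.single j 1) else 0 := by
  split_ifs with h
  · subst h
    rw [divX_apply, divX_apply, X_mul_divMonomial, sub_eq_iff_eq_add', divMonomial_add_modMonomial_single]
  · ext a
    rw [coeff_sub, coeff_divX, coeff_X_mul', coeff_X_mul', coeff_zero, sub_eq_zero]
    have hs : l ∈ (Finsupp.single j 1 + a).support ↔ l ∈ a.support := by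
      simp [Ne.symm h]
    simp only [hs]
    split_ifs with hl
    · rw [coeff_divX, add_tsub_assoc_of_le]
      rw [Finsupp.single_le_iff]
      exact Nat.one_le_iff_ne_zero.mpr (by simpa using hl)
    · rfl

lemma coeff_modMonomial_single (j : ι) (f : MvPolynomial ι k) (a : ι →₀ ℕ) :
    coeff a (modMonomial f (Finsupp.single j 1)) = if a j = 0 then coeff a f else 0 := by
  split_ifs with h
  · rw [coeff_modMonomial_of_not_le]; simp [Finsupp.single_le_iff, h]
  · rw [coeff_modMonomial_of_le]; rw [Finsupp.single_le_iff]; omega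

variable [LinearOrder ι] [Fintype ι]

/-- Subtracting this boundary from a cycle leaves exactly its terms that involve neither `e_j` nor
`X_j`. -/
lemma koszulD_koszulExt_divX (j : ι) (z : Finset ι → MvPolynomial ι k)
    (hz : koszulD (X : ι → MvPolynomial ι k) z = 0) (S : Finset ι) :
    koszulD (X : ι → MvPolynomial ι k) (koszulExt j fun S => divX j (z S)) S =
      z S - if j ∈ S then 0 else modMonomial (z S) (Finsupp.single j 1) := by
  have h := congrFun (koszulD_koszulExt_add (X : ι → MvPolynomial ι k) (divX j) j z) S
  have h0 : koszulExt j (fun S => divX j (koszulD (X : ι → MvPolynomial ι k) z S)) = 0 := by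
    rw [hz]; ext; simp [koszulExt_apply]
  have h1 : (∑ l, koszulInt l fun S => divX j ((X l : MvPolynomial ι k) • z S) - (X l : MvPolynomial ι k) • divX j (z S)) =
      koszulInt j fun S => modMonomial (z S) (Finsupp.single j 1) := by
    simp only [smul_eq_mul, divX_X_mul_sub]
    rw [Finset.sum_eq_single j]
    · simp
    · intro l _ hl
      simp only [hl, if_false]
      exact map_zero (koszulInt l)
    · simp
  rw [h0, h1, add_zero] at h
  rw [h, Pi.add_apply, koszulExt_koszulInt_self_apply, Pi.smul_apply, smul_eq_mul, divX_apply]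
  have h2 := divMonomial_add_modMonomial_single (z S) j
  split_ifs
  · rw [h2, sub_zero]
  · rw [add_zero]; exact eq_sub_of_add_eq h2

/-- Variables are eliminated one at a time. `hmod` keeps the remainder in `Q`, so that `hdiv`
applies again; once all variables are gone only the constant term of `z ∅` could survive. -/
lemma exists_koszulD_eq_of_divX {Q Q' : Ideal (MvPolynomial ι k)}
    (hmod : ∀ f ∈ Q, ∀ j, modMonomial f (Finsupp.single j 1) ∈ Q)
    (hdiv : ∀ f ∈ Q, ∀ j, divMonomial f (Finsupp.single j 1) ∈ Q')
    (z : Finset ι → MvPolynomial ι k) (hzQ : ∀ S, z S ∈ Q) (hz : koszulD (X : ι → MvPolynomial ι k) z = 0)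
    (h0 : constantCoeff (z ∅) = 0) :
    ∃ w : Finset ι → MvPolynomial ι k, (∀ S, w S ∈ Q') ∧ koszulD (X : ι → MvPolynomial ι k) w = z := by
  suffices ∀ F : Finset ι, ∃ w : Finset ι → MvPolynomial ι k, (∀ S, w S ∈ Q') ∧
      (∀ S, (z - koszulD (X : ι → MvPolynomial ι k) w) S ∈ Q) ∧ ∀ S a, coeff a ((z - koszulD (X : ι → MvPolynomial ι k) w) S) =
        if ∃ j ∈ F, j ∈ S ∨ a j ≠ 0 then 0 else coeff a (z S) by
    obtain ⟨w, hw, -, h⟩ := this Finset.univ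
    refine ⟨w, hw, (sub_eq_zero.mp ?_).symm⟩
    ext S a
    rw [h S a, Pi.zero_apply, coeff_zero]
    split_ifs with hn
    · rfl
    · push Not at hn
      have hS : S = ∅ := Finset.eq_empty_of_forall_notMem fun j => (hn j (Finset.mem_univ _)).1
      have ha : a = 0 := Finsupp.ext fun j => (hn j (Finset.mem_univ _)).2
      rw [hS, ha]
      exact h0
  intro F
  induction F using Finset.induction_on with
  | empty => exact ⟨0, fun S => Q'.zero_mem, by simpa using hzQ, by simp⟩
  | insert j F hj ih =>
    obtain ⟨w, hw, hQ, hc⟩ := ih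
    set z' := z - koszulD (X : ι → MvPolynomial ι k) w with hz'
    have hcyc : koszulD (X : ι → MvPolynomial ι k) z' = 0 := by rw [hz', map_sub, koszulD_koszulD, hz, sub_zero]
    have key : ∀ S, (z - koszulD (X : ι → MvPolynomial ι k) (w + koszulExt j fun S => divX j (z' S))) S =
        if j ∈ S then 0 else modMonomial (z' S) (Finsupp.single j 1) := by
      intro S
      rw [map_add, ← sub_sub, ← hz', Pi.sub_apply, koszulD_koszulExt_divX j z' hcyc, sub_sub_cancel]
    refine ⟨w + koszulExt j fun S => divX j (z' S), fun S => ?_, fun S => ?_, fun S a => ?_⟩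
    · refine Q'.add_mem (hw S) ?_
      rw [koszulExt_apply]
      split_ifs
      · exact zsmul_mem (hdiv _ (hQ _) j) _
      · exact Q'.zero_mem
    · rw [key]
      split_ifs
      · exact Q.zero_mem
      · exact hmod _ (hQ S) j
    · rw [key]
      by_cases hjS : j ∈ S
      · rw [if_pos hjS, coeff_zero, if_pos ⟨j, Finset.mem_insert_self _ _, Or.inl hjS⟩]
      · rw [if_neg hjS, coeff_modMonomial_single]
        by_cases ha : a j = 0
        · rw [if_pos ha, hc S a]
          congr 1
          simp [hjS, ha]
        · rw [if_neg ha, if_pos ⟨j, Finset.mem_insert_self _ _, Or.inr ha⟩]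

lemma koszulAcyclic_mvPolynomial :
    KoszulAcyclic (X : ι → MvPolynomial ι k) (MvPolynomial ι k) := by
  intro z h0 hz
  obtain ⟨w, -, hw⟩ := exists_koszulD_eq_of_divX (Q := ⊤) (Q' := ⊤) (by simp) (by simp) z (by simp)
    hz (by simp [h0])
  exact ⟨w, hw⟩

end Monomial

/-! ### The Euler derivation and homogeneity -/

section Euler

variable {ι k : Type*} [Fintype ι]

/-- The Euler derivation `∑ X_j ∂/∂X_j`. -/
def eulerDerivation (ι k : Type*) [Fintype ι] [CommRing k] :
    Derivation k (MvPolynomial ι k) (MvPolynomial ι k) :=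
  ∑ j, (X j : MvPolynomial ι k) • pderiv j

lemma eulerDerivation_apply [CommRing k] (f : MvPolynomial ι k) :
    eulerDerivation ι k f = ∑ j, X j * pderiv j f := by
  have h := congrFun (map_sum (Derivation.coeFnAddMonoidHom (R := k) (A := MvPolynomial ι k)
    (M := MvPolynomial ι k)) (fun j => (X j : MvPolynomial ι k) • pderiv j) Finset.univ) f
  rw [Finset.sum_apply] at h
  exact h

lemma coeff_eulerDerivation [CommRing k] (f : MvPolynomial ι k) (a : ι →₀ ℕ) :
    coeff a (eulerDerivation ι k f) = (a.degree : k) * coeff a f := by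
  classical
  have h : ∀ n, eulerDerivation ι k (homogeneousComponent n f) =
      n • homogeneousComponent n f := fun n => by
    rw [eulerDerivation_apply]
    exact (homogeneousComponent_isHomogeneous n f).sum_X_mul_pderiv
  conv_lhs => rw [← sum_homogeneousComponent f]
  conv_rhs => rw [← sum_homogeneousComponent f]
  simp only [map_sum, h, coeff_sum, coeff_smul, Finset.mul_sum]
  refine Finset.sum_congr rfl fun n _ => ?_
  rw [coeff_homogeneousComponent]
  split_ifs with hn
  · rw [hn, nsmul_eq_mul]
  · simp

/-- In characteristic zero an ideal stable under the Euler derivation is homogeneous. -/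
lemma homogeneousComponent_mem_of_eulerDerivation_mem [Field k] [CharZero k]
    {Q : Ideal (MvPolynomial ι k)} (hQ : ∀ f ∈ Q, eulerDerivation ι k f ∈ Q)
    {f : MvPolynomial ι k} (hf : f ∈ Q) (n : ℕ) : homogeneousComponent n f ∈ Q := by
  classical
  -- Here `g` is `∏ (E - i)` applied to `f`. With `i` running over the degrees up to `f.totalDegree`
  -- other than `n`, this kills every component except the `n`-th, which it scales by a nonzero
  -- constant.
  have key : ∀ T : Finset ℕ, ∃ g ∈ Q, ∀ a : ι →₀ ℕ,
      coeff a g = (∏ i ∈ T, ((a.degree : k) - i)) * coeff a f := by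
    intro T
    induction T using Finset.induction_on with
    | empty => exact ⟨f, hf, by simp⟩
    | insert i T hi ih =>
      obtain ⟨g, hg, h⟩ := ih
      refine ⟨eulerDerivation ι k g - C (i : k) * g,
        Q.sub_mem (hQ g hg) (Q.mul_mem_left _ hg), fun a => ?_⟩
      rw [coeff_sub, coeff_eulerDerivation, coeff_C_mul, h, Finset.prod_insert hi]
      ring
  obtain ⟨g, hg, h⟩ := key ((Finset.range (f.totalDegree + 1)).erase n)
  set c : k := ∏ i ∈ (Finset.range (f.totalDegree + 1)).erase n, ((n : k) - i) with hc
  have hc0 : c ≠ 0 := by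
    refine Finset.prod_ne_zero_iff.mpr fun i hi => sub_ne_zero.mpr ?_
    exact_mod_cast (Finset.ne_of_mem_erase hi).symm
  have : homogeneousComponent n f = C c⁻¹ * g := by
    ext a
    rw [coeff_homogeneousComponent, coeff_C_mul, h]
    split_ifs with ha
    · rw [ha, ← hc, inv_mul_cancel_left₀ hc0]
    · by_cases hfa : coeff a f = 0
      · simp [hfa]
      · rw [Finset.prod_eq_zero (i := a.degree), zero_mul, mul_zero]
        · refine Finset.mem_erase.mpr ⟨ha, Finset.mem_range.mpr (Nat.lt_succ_of_le ?_)⟩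
          rw [Finsupp.degree_apply]
          exact le_totalDegree (mem_support_iff.mpr hfa)
        · exact sub_self _
  rw [this]
  exact Q.mul_mem_left _ hg

lemma eulerDerivation_mem_of_homogeneousComponent_mem [CommRing k] {Q : Ideal (MvPolynomial ι k)}
    {f : MvPolynomial ι k} (hf : ∀ n, homogeneousComponent n f ∈ Q) :
    eulerDerivation ι k f ∈ Q := by
  rw [← sum_homogeneousComponent f, map_sum]
  refine Q.sum_mem fun n _ => ?_
  rw [eulerDerivation_apply, (homogeneousComponent_isHomogeneous n f).sum_X_mul_pderiv]
  exact nsmul_mem (hf n) n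

end Euler

/-! ### Exterior derivative and Cartan's formula -/

section DeRham

variable {ι k : Type*} [LinearOrder ι] [Fintype ι]

/-- The exterior derivative on `Λ ⊗ k[X]`. -/
def deRham [CommRing k] : (Finset ι → MvPolynomial ι k) →+ (Finset ι → MvPolynomial ι k) where
  toFun z := ∑ j, koszulExt j fun S => pderiv j (z S)
  map_zero' := by
    simp only [Pi.zero_apply, map_zero]
    exact Finset.sum_eq_zero fun j _ => map_zero (koszulExt j)
  map_add' a b := by
    simp only [Pi.add_apply, map_add]
    rw [← Finset.sum_add_distrib]
    exact Finset.sum_congr rfl fun j _ => map_add (koszulExt j) _ _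

lemma deRham_eq [CommRing k] (z : Finset ι → MvPolynomial ι k) :
    deRham z = ∑ j, koszulExt j fun S => pderiv j (z S) := rfl

/-- The commutator of `∂/∂x_j` with `X_l` is `δ_{jl}`, so the error terms sum to `∑ e_j ι_j`, which
counts the elements of `S`. -/
lemma koszulD_deRham_add [CommRing k] (z : Finset ι → MvPolynomial ι k) (S : Finset ι) :
    (koszulD (X : ι → MvPolynomial ι k) (deRham z) + deRham (koszulD (X : ι → MvPolynomial ι k) z)) S =
      eulerDerivation ι k (z S) + S.card • z S := by
  have h : ∀ j, koszulD (X : ι → MvPolynomial ι k) (koszulExt j fun S => pderiv j (z S)) +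
      koszulExt j (fun S => pderiv j (koszulD (X : ι → MvPolynomial ι k) z S)) =
      (X j : MvPolynomial ι k) • (fun S => pderiv j (z S)) + koszulExt j (koszulInt j z) := by
    intro j
    have := koszulD_koszulExt_add (X : ι → MvPolynomial ι k) (pderiv j).toLinearMap.toAddMonoidHom j z
    refine this.trans ?_
    congr 2
    rw [Finset.sum_eq_single j]
    · congr 1
      ext1 S
      change pderiv j (X j * z S) - X j * pderiv j (z S) = z S
      rw [pderiv_mul, pderiv_X_self]; ring
    · intro l _ hl
      refine (congrArg (koszulInt l) (funext fun S => ?_)).trans (map_zero (koszulInt l))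
      change pderiv j (X l * z S) - X l * pderiv j (z S) = 0
      rw [pderiv_mul, pderiv_X_of_ne hl]; ring
    · simp
  rw [deRham_eq, deRham_eq, map_sum, ← Finset.sum_add_distrib, Finset.sum_congr rfl fun j _ => h j,
    Finset.sum_add_distrib, Pi.add_apply, Finset.sum_apply, Finset.sum_apply,
    eulerDerivation_apply]
  congr 1
  simp only [koszulExt_koszulInt_self_apply]
  simp

lemma constantCoeff_koszulD_empty [CommRing k] (z : Finset ι → MvPolynomial ι k) :
    constantCoeff (koszulD (X : ι → MvPolynomial ι k) z ∅) = 0 := by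
  rw [koszulD_apply_empty, map_sum]
  simp

lemma exists_koszulD_eq_of_pderiv [Field k] [CharZero k] {Q Q' : Ideal (MvPolynomial ι k)}
    (hcomp : ∀ f ∈ Q, ∀ n, homogeneousComponent n f ∈ Q)
    (hder : ∀ f ∈ Q, ∀ j, pderiv j f ∈ Q')
    (z : Finset ι → MvPolynomial ι k) (hzQ : ∀ S, z S ∈ Q) (hz : koszulD (X : ι → MvPolynomial ι k) z = 0)
    (h0 : constantCoeff (z ∅) = 0) :
    ∃ w : Finset ι → MvPolynomial ι k, (∀ S, w S ∈ Q') ∧ koszulD (X : ι → MvPolynomial ι k) w = z := by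
  classical
  -- `y` is `z` divided by its total weight. In weight zero the inverse is `0⁻¹ = 0`, harmless since
  -- `h0` makes that coefficient of `z` vanish.
  set y : Finset ι → MvPolynomial ι k := fun S =>
    ∑ n ∈ Finset.range ((z S).totalDegree + 1),
      C ((n : k) + S.card)⁻¹ * homogeneousComponent n (z S) with hy
  have hycoeff : ∀ S a, coeff a (y S) = ((a.degree : k) + S.card)⁻¹ * coeff a (z S) := by
    intro S a
    conv_rhs => rw [← sum_homogeneousComponent (z S)]
    simp only [hy, coeff_sum, coeff_C_mul, Finset.mul_sum, coeff_homogeneousComponent]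
    refine Finset.sum_congr rfl fun n _ => ?_
    split_ifs with h
    · rw [h]
    · simp
  have hyQ : ∀ S, y S ∈ Q := fun S =>
    Q.sum_mem fun n _ => Q.mul_mem_left _ (hcomp _ (hzQ S) n)
  clear_value y
  have hcoeff : ∀ (u : Finset ι → MvPolynomial ι k) S a,
      coeff a ((koszulD (X : ι → MvPolynomial ι k) (deRham u) + deRham (koszulD (X : ι → MvPolynomial ι k) u)) S) =
        ((a.degree : k) + S.card) * coeff a (u S) := by
    intro u S a
    rw [koszulD_deRham_add, coeff_add, coeff_eulerDerivation, coeff_smul, nsmul_eq_mul]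
    ring
  have hne : ∀ (S : Finset ι) (a : ι →₀ ℕ), (a.degree : k) + S.card = 0 → S = ∅ ∧ a = 0 := by
    intro S a h
    have : a.degree + S.card = 0 := by exact_mod_cast h
    exact ⟨Finset.card_eq_zero.mp (by omega), (Finsupp.degree_eq_zero_iff a).mp (by omega)⟩
  have hL : koszulD (X : ι → MvPolynomial ι k) (deRham y) + deRham (koszulD (X : ι → MvPolynomial ι k) y) = z := by
    ext S a
    rw [hcoeff, hycoeff]
    by_cases h : (a.degree : k) + S.card = 0
    · obtain ⟨rfl, rfl⟩ := hne S a h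
      rw [h, zero_mul]
      exact h0.symm
    · rw [mul_inv_cancel_left₀ h]
  -- The differential commutes with the weight operator, so weight times `koszulD y` is `koszulD z =
  -- 0`; in weight zero, `koszulD y` has no constant term anyway.
  have hcyc : koszulD (X : ι → MvPolynomial ι k) y = 0 := by
    have h1 : koszulD (X : ι → MvPolynomial ι k) (deRham (koszulD (X : ι → MvPolynomial ι k) y)) = 0 := by
      have := congrArg (koszulD (X : ι → MvPolynomial ι k)) hL
      rwa [map_add, koszulD_koszulD, zero_add, hz] at this
    ext S a
    have h2 := hcoeff (koszulD (X : ι → MvPolynomial ι k) y) S a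
    rw [h1, koszulD_koszulD, map_zero, add_zero, Pi.zero_apply, coeff_zero] at h2
    rcases mul_eq_zero.mp h2.symm with h | h
    · obtain ⟨rfl, rfl⟩ := hne S a h
      exact constantCoeff_koszulD_empty y
    · exact h
  refine ⟨deRham y, fun S => ?_, ?_⟩
  · rw [deRham_eq, Finset.sum_apply]
    refine Q'.sum_mem fun j _ => ?_
    rw [koszulExt_apply]
    split_ifs
    · exact zsmul_mem (hder _ (hyQ _) j) _
    · exact Q'.zero_mem
  · rwa [hcyc, map_zero, add_zero] at hL

end DeRham

/-! ### Dimension shifting along a resolution -/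

section Syzygy

variable {ι R : Type*} [LinearOrder ι] [Fintype ι] [CommRing R] {x : ι → R}
  {X₀ X₁ X₂ Y₀ Y₁ Y₂ : Type*} [AddCommGroup X₀] [AddCommGroup X₁] [AddCommGroup X₂]
  [AddCommGroup Y₀] [AddCommGroup Y₁] [AddCommGroup Y₂] [Module R X₀] [Module R X₁] [Module R X₂]
  [Module R Y₀] [Module R Y₁] [Module R Y₂]

lemma koszulD_update_empty [DecidableEq (Finset ι)] (z : Finset ι → X₀) (c : X₀) :
    koszulD x (Function.update z ∅ c) = koszulD x z := by
  ext S
  rw [koszulD_apply, koszulD_apply]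
  refine Finset.sum_congr rfl fun l _ => ?_
  rw [koszulInt_apply, koszulInt_apply, Function.update_of_ne (Finset.insert_ne_empty l S)]

/-- Vanishing of the map induced on Koszul homology in positive exterior degrees passes to
syzygies. -/
lemma exists_koszulD_eq_of_syzygy (δ : X₁ →ₗ[R] X₀) (δ' : Y₁ →ₗ[R] Y₀) (φ₁ : X₁ →ₗ[R] Y₁)
    (φ₀ : X₀ →ₗ[R] Y₀) (comm : ∀ a, φ₀ (δ a) = δ' (φ₁ a)) (hX : KoszulAcyclic x X₁)
    (h : ∀ z : Finset ι → X₀, (∀ S, z S ∈ LinearMap.range δ) → z ∅ = 0 → koszulD x z = 0 →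
      ∃ v : Finset ι → Y₁, koszulD x (fun S => δ' (v S)) = fun S => φ₀ (z S))
    (z : Finset ι → X₁) (hz : ∀ S, δ (z S) = 0) (h0 : z ∅ = 0) (hcyc : koszulD x z = 0) :
    ∃ w : Finset ι → Y₁, (∀ S, δ' (w S) = 0) ∧ koszulD x w = fun S => φ₁ (z S) := by
  classical
  obtain ⟨w, hw⟩ : ∃ w : Finset ι → X₁, w ∅ = 0 ∧ koszulD x w = z := by
    obtain ⟨w, hw⟩ := hX z h0 hcyc
    exact ⟨Function.update w ∅ 0, Function.update_self .., by rw [koszulD_update_empty, hw]⟩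
  obtain ⟨v, hv⟩ := h (fun S => δ (w S)) (fun S => ⟨_, rfl⟩) (by simp [hw.1])
    (by rw [koszulD_comp, hw.2]; exact funext hz)
  -- Subtracting a boundary does not change the Koszul differential, and this one moves `φ₁ w` into
  -- the kernel of `δ'`.
  refine ⟨(fun S => φ₁ (w S)) - koszulD x v, fun S => ?_, ?_⟩
  · have := congrFun hv S
    rw [koszulD_comp] at this
    beta_reduce at this
    rw [Pi.sub_apply, map_sub, this, comm, sub_self]
  · rw [map_sub, koszulD_koszulD, sub_zero, koszulD_comp, hw.2]

/-- The element `p` is a cycle modulo `x`; the conclusion corrects `φ₂ p` modulo `x` to an honest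
cycle. The Koszul chain `∑ e_j ⊗ q_j` has differential `δ₁ p`, so its image under `δ₀` is a Koszul
cycle to which `h` applies. -/
lemma exists_syzygy_sub_sum_smul (δ₁ : X₂ →ₗ[R] X₁) (δ₀ : X₁ →ₗ[R] X₀) (δ₁' : Y₂ →ₗ[R] Y₁)
    (δ₀' : Y₁ →ₗ[R] Y₀) (φ₂ : X₂ →ₗ[R] Y₂) (φ₁ : X₁ →ₗ[R] Y₁) (φ₀ : X₀ →ₗ[R] Y₀)
    (comm₁ : ∀ a, φ₁ (δ₁ a) = δ₁' (φ₂ a)) (comm₀ : ∀ a, φ₀ (δ₀ a) = δ₀' (φ₁ a))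
    (hδ : ∀ a, δ₀ (δ₁ a) = 0) (hexact : ∀ b, δ₀' b = 0 → ∃ c, δ₁' c = b)
    (h : ∀ z : Finset ι → X₀, (∀ S, z S ∈ LinearMap.range δ₀) → z ∅ = 0 → koszulD x z = 0 →
      ∃ v : Finset ι → Y₁, koszulD x (fun S => δ₀' (v S)) = fun S => φ₀ (z S))
    (p : X₂) (q : ι → X₁) (hp : δ₁ p = ∑ j, x j • q j) :
    ∃ u : ι → Y₂, δ₁' (φ₂ p - ∑ j, x j • u j) = 0 := by
  classical
  set e : Finset ι → X₁ := fun S => ∑ j, if S = {j} then q j else 0 with he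
  have he1 : ∀ l, e {l} = q l := fun l => by simp [he, Finset.singleton_inj]
  have he0 : e ∅ = 0 := by
    refine Finset.sum_eq_zero fun j _ => if_neg (Finset.singleton_ne_empty j).symm
  have hDe0 : koszulD x e ∅ = δ₁ p := by simp only [koszulD_apply_empty, he1, hp]
  have hDe : ∀ S, S ≠ ∅ → koszulD x e S = 0 := by
    intro S hS
    rw [koszulD_apply]
    refine Finset.sum_eq_zero fun l _ => ?_
    rw [koszulInt_apply]
    split_ifs with hl
    · exact smul_zero _
    · simp only [he]
      rw [Finset.sum_eq_zero, smul_zero, smul_zero]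
      intro j _
      refine if_neg fun hj => hS ?_
      have h1 : (insert l S).card = 1 := by rw [hj, Finset.card_singleton]
      rw [Finset.card_insert_of_notMem hl] at h1
      exact Finset.card_eq_zero.mp (by omega)
  obtain ⟨v, hv⟩ := h (fun S => δ₀ (e S)) (fun S => ⟨_, rfl⟩) (by simp [he0]) (by
    rw [koszulD_comp]
    ext S
    by_cases hS : S = ∅
    · rw [hS, hDe0, hδ, Pi.zero_apply]
    · rw [hDe S hS, map_zero, Pi.zero_apply])
  -- `φ₁ e - koszulD v` now lifts through `δ₁'` to `u`, and comparing differentials at `∅` gives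
  -- `δ₁' (φ₂ p) = ∑ x_j δ₁' (u {j})`.
  have hker : ∀ S, δ₀' (φ₁ (e S) - koszulD x v S) = 0 := by
    intro S
    have := congrFun hv S
    rw [koszulD_comp] at this
    beta_reduce at this
    rw [map_sub, this, comm₀, sub_self]
  choose u hu using fun S => hexact _ (hker S)
  refine ⟨fun j => u {j}, ?_⟩
  have h1 : koszulD x ((fun S => φ₁ (e S)) - koszulD x v) ∅ = φ₁ (δ₁ p) := by
    rw [map_sub, koszulD_koszulD, sub_zero, koszulD_comp]
    exact congrArg φ₁ hDe0
  rw [koszulD_apply_empty] at h1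
  rw [map_sub, ← comm₁, ← h1, map_sum, sub_eq_zero]
  refine Finset.sum_congr rfl fun j _ => ?_
  rw [map_smul, hu]
  rfl

end Syzygy

/-! ### Vanishing in the tensor product with the quotient by `x` -/

section Quotient

variable {ι R M : Type*} [Fintype ι] [CommRing R] {x : ι → R} [AddCommGroup M] [Module R M]

lemma exists_eq_sum_smul_of_mem_span_range_smul_top {m : M}
    (hm : m ∈ Ideal.span (Set.range x) • (⊤ : Submodule R M)) :
    ∃ q : ι → M, m = ∑ j, x j • q j := by
  classical
  induction hm using Submodule.smul_induction_on' with
  | smul a ha n _ =>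
    obtain ⟨c, rfl⟩ := (Ideal.mem_span_range_iff_exists_fun).mp ha
    refine ⟨fun j => c j • n, ?_⟩
    rw [Finset.sum_smul]
    exact Finset.sum_congr rfl fun j _ => by rw [smul_smul, mul_comm]
  | add a _ b _ ha hb =>
    obtain ⟨q, rfl⟩ := ha
    obtain ⟨q', rfl⟩ := hb
    exact ⟨q + q', by simp [Finset.sum_add_distrib]⟩

lemma one_tmul_eq_zero_iff_exists_eq_sum_smul (m : M) :
    (1 : R ⧸ Ideal.span (Set.range x)) ⊗ₜ[R] m = 0 ↔ ∃ q : ι → M, m = ∑ j, x j • q j := by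
  have h : (TensorProduct.quotTensorEquivQuotSMul M (Ideal.span (Set.range x)))
      ((1 : R ⧸ Ideal.span (Set.range x)) ⊗ₜ[R] m) = Submodule.Quotient.mk m := by
    have := TensorProduct.quotTensorEquivQuotSMul_mk_tmul (Ideal.span (Set.range x)) 1 m
    rwa [map_one, one_smul] at this
  rw [← (TensorProduct.quotTensorEquivQuotSMul M (Ideal.span (Set.range x))).map_eq_zero_iff, h,
    Submodule.Quotient.mk_eq_zero]
  refine ⟨exists_eq_sum_smul_of_mem_span_range_smul_top, ?_⟩
  rintro ⟨q, rfl⟩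
  exact Submodule.sum_mem _ fun j _ =>
    Submodule.smul_mem_smul (Ideal.subset_span ⟨j, rfl⟩) Submodule.mem_top

end Quotient

open CategoryTheory

/-! ### From Koszul boundaries to vanishing on Tor -/

section Tor

universe u

variable {R : Type u} [CommRing R]

/-- Homology is a quotient of cycles and embeds in opcycles, so it suffices that the map from cycles
to opcycles vanishes; boundaries die in opcycles. -/
lemma ModuleCat.homologyMap_eq_zero {K L : ChainComplex (ModuleCat.{u} R) ℕ} (φ : K ⟶ L) (i : ℕ)
    (h : ∀ c : K.X i, (∀ j, K.d i j c = 0) → ∃ b : L.X (i + 1), L.d (i + 1) i b = φ.f i c) :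
    HomologicalComplex.homologyMap φ i = 0 := by
  rw [← cancel_epi (K.homologyπ i), ← cancel_mono (L.homologyι i)]
  simp only [HomologicalComplex.homologyπ_naturality, Limits.comp_zero, Limits.zero_comp,
    Category.assoc, HomologicalComplex.homology_π_ι, HomologicalComplex.cyclesMap_i_assoc]
  ext c
  obtain ⟨b, hb⟩ := h (K.iCycles i c) fun j => by
    exact ConcreteCategory.congr_hom (K.iCycles_d i j) c
  have h2 := ConcreteCategory.congr_hom (L.d_pOpcycles (i + 1) i) b
  simp only [ModuleCat.hom_comp, LinearMap.comp_apply] at h2 ⊢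
  erw [← hb]
  exact h2

variable {ι : Type} [LinearOrder ι] [Fintype ι] {x : ι → R}

theorem tor_map_eq_zero_of_koszul (hR : KoszulAcyclic x R) {M N : ModuleCat.{u} R} (f : M ⟶ N)
    (h : ∀ z : Finset ι → M, koszulD x z = 0 → ∃ w : Finset ι → N, koszulD x w = fun S => f (z S))
    (i : ℕ) :
    ((Tor (ModuleCat.{u} R) i).obj (ModuleCat.of R (R ⧸ Ideal.span (Set.range x)))).map f = 0 := by
  set P := ProjectiveResolution.of M
  set P' := ProjectiveResolution.of N
  set φ := ProjectiveResolution.lift f P P'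
  have hproj : ∀ n, KoszulAcyclic x (P.complex.X n) := fun n => by
    have : Module.Projective R (P.complex.X n) :=
      (IsProjective.iff_projective _).mpr (P.projective n)
    exact hR.of_projective
  let ε : P.complex.X 0 →ₗ[R] M := (P.π.f 0 : P.complex.X 0 ⟶ M).hom
  let ε' : P'.complex.X 0 →ₗ[R] N := (P'.π.f 0 : P'.complex.X 0 ⟶ N).hom
  have hε' : Function.Surjective ε' := (ModuleCat.epi_iff_surjective (P'.π.f 0)).mp inferInstance
  have hcomm0 : ∀ a, f (ε a) = ε' (φ.f 0 a) := fun a =>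
    (ConcreteCategory.congr_hom (ProjectiveResolution.lift_commutes_zero f P P') a).symm
  have hcomm : ∀ n a, φ.f n (P.complex.d (n + 1) n a) = P'.complex.d (n + 1) n (φ.f (n + 1) a) :=
    fun n a => (ConcreteCategory.congr_hom (φ.comm (n + 1) n) a).symm
  have hex0 : ∀ a, ε' a = 0 → ∃ b, P'.complex.d 1 0 b = a :=
    (ShortComplex.moduleCat_exact_iff _).mp P'.exact₀
  have hex : ∀ n a, P'.complex.d (n + 1) n a = 0 → ∃ b, P'.complex.d (n + 2) (n + 1) b = a :=
    fun n => (ShortComplex.moduleCat_exact_iff _).mp (P'.exact_succ n)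
  have hdε : ∀ a, ε (P.complex.d 1 0 a) = 0 := fun a =>
    ConcreteCategory.congr_hom P.complex_d_comp_π_f_zero a
  have hdd : ∀ n a, P.complex.d (n + 1) n (P.complex.d (n + 2) (n + 1) a) = 0 := fun n a =>
    ConcreteCategory.congr_hom (P.complex.d_comp_d (n + 2) (n + 1) n) a
  have hB0 : ∀ z : Finset ι → M, (∀ S, z S ∈ LinearMap.range ε) → z ∅ = 0 → koszulD x z = 0 →
      ∃ v : Finset ι → P'.complex.X 0, koszulD x (fun S => ε' (v S)) = fun S => f (z S) := by
    intro z _ _ hz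
    obtain ⟨w, hw⟩ := h z hz
    choose v hv using fun S => hε' (w S)
    exact ⟨v, by simpa only [hv] using hw⟩
  -- The Koszul condition for the successive syzygy modules, in positive exterior degrees.
  have hB : ∀ n, ∀ z : Finset ι → P.complex.X n,
      (∀ S, z S ∈ LinearMap.range (P.complex.d (n + 1) n).hom) → z ∅ = 0 → koszulD x z = 0 →
      ∃ v : Finset ι → P'.complex.X (n + 1),
        koszulD x (fun S => (P'.complex.d (n + 1) n).hom (v S)) = fun S => (φ.f n).hom (z S) := by
    intro n
    induction n with
    | zero =>
      intro z hz h0 hcyc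
      obtain ⟨w, hw, hw'⟩ := exists_koszulD_eq_of_syzygy ε ε' (φ.f 0).hom f.hom hcomm0 (hproj 0) hB0
        z (fun S => by obtain ⟨a, ha⟩ := hz S; rw [← ha]; exact hdε a) h0 hcyc
      choose v hv using fun S => hex0 _ (hw S)
      refine ⟨v, ?_⟩
      rw [← hw']
      exact congrArg _ (funext hv)
    | succ n ih =>
      intro z hz h0 hcyc
      obtain ⟨w, hw, hw'⟩ := exists_koszulD_eq_of_syzygy (P.complex.d (n + 1) n).hom
        (P'.complex.d (n + 1) n).hom (φ.f (n + 1)).hom (φ.f n).hom (hcomm n) (hproj (n + 1)) ih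
        z (fun S => by obtain ⟨a, ha⟩ := hz S; rw [← ha]; exact hdd n a) h0 hcyc
      choose v hv using fun S => hex n _ (hw S)
      refine ⟨v, ?_⟩
      rw [← hw']
      exact congrArg _ (funext hv)
  -- A cycle of the tensored complex maps to a boundary, written modulo `x` on representatives. The
  -- form `j + 1 = n` makes the cycle condition vacuous at `n = 0`.
  have key : ∀ n (p : P.complex.X n),
      (∀ j, j + 1 = n → ∃ q : ι → P.complex.X j, P.complex.d n j p = ∑ l, x l • q l) →
      ∃ (u : ι → P'.complex.X n) (b : P'.complex.X (n + 1)),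
        P'.complex.d (n + 1) n b = φ.f n p - ∑ l, x l • u l := by
    intro n p hp
    match n with
    | 0 =>
      classical
      -- In degree zero, `h` applied to a chain concentrated at `∅` says that `f` maps `M` into `(x)
      -- N`.
      obtain ⟨w, hw⟩ := h (fun S => if S = ∅ then ε p else 0) (by
        ext S
        rw [koszulD_apply]
        refine Finset.sum_eq_zero fun l _ => ?_
        rw [koszulInt_apply, if_neg (Finset.insert_ne_empty l S), smul_zero, ite_self, smul_zero])
      have hw0 := congrFun hw ∅
      rw [koszulD_apply_empty, if_pos rfl] at hw0
      choose v hv using fun S => hε' (w S)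
      obtain ⟨b, hb⟩ := hex0 (φ.f 0 p - ∑ l, x l • v {l}) (by
        rw [map_sub, map_sum]
        simp only [map_smul, hv]
        rw [hw0, ← hcomm0, sub_self])
      exact ⟨fun l => v {l}, b, hb⟩
    | 1 =>
      obtain ⟨q, hq⟩ := hp 0 rfl
      obtain ⟨u, hu⟩ := exists_syzygy_sub_sum_smul (P.complex.d 1 0).hom ε (P'.complex.d 1 0).hom ε'
        (φ.f 1).hom (φ.f 0).hom f.hom (hcomm 0) hcomm0 hdε hex0 hB0 p q hq
      obtain ⟨b, hb⟩ := hex 0 _ hu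
      exact ⟨u, b, hb⟩
    | n + 2 =>
      obtain ⟨q, hq⟩ := hp (n + 1) rfl
      obtain ⟨u, hu⟩ := exists_syzygy_sub_sum_smul (P.complex.d (n + 2) (n + 1)).hom
        (P.complex.d (n + 1) n).hom (P'.complex.d (n + 2) (n + 1)).hom (P'.complex.d (n + 1) n).hom
        (φ.f (n + 2)).hom (φ.f (n + 1)).hom (φ.f n).hom (hcomm (n + 1)) (hcomm n) (hdd n)
        (hex n) (hB n) p q hq
      obtain ⟨b, hb⟩ := hex (n + 1) _ hu
      exact ⟨u, b, hb⟩
  set A := ModuleCat.of R (R ⧸ Ideal.span (Set.range x))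
  set F := (MonoidalCategory.tensoringLeft (ModuleCat.{u} R)).obj A with hF
  have hnat := ProjectiveResolution.isoLeftDerivedObj_hom_naturality f P P' φ
    (ProjectiveResolution.lift_commutes_zero f P P') F i
  have hzero : HomologicalComplex.homologyMap
      ((F.mapHomologicalComplex (ComplexShape.down ℕ)).map φ) i = 0 := by
    refine ModuleCat.homologyMap_eq_zero _ i fun c hc => ?_
    obtain ⟨p, rfl⟩ := TensorProduct.mk_surjective R (P.complex.X i)
      (R ⧸ Ideal.span (Set.range x)) Ideal.Quotient.mk_surjective c
    obtain ⟨u, b, hb⟩ := key i p fun j _ =>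
      (one_tmul_eq_zero_iff_exists_eq_sum_smul _).mp (hc j)
    refine ⟨(1 : R ⧸ Ideal.span (Set.range x)) ⊗ₜ[R] b, ?_⟩
    have h3 : (1 : R ⧸ Ideal.span (Set.range x)) ⊗ₜ[R] (P'.complex.d (i + 1) i b) =
        (1 : R ⧸ Ideal.span (Set.range x)) ⊗ₜ[R] (φ.f i p) := by
      rw [hb, TensorProduct.tmul_sub, (one_tmul_eq_zero_iff_exists_eq_sum_smul _).mpr ⟨u, rfl⟩,
        sub_zero]
    exact h3
  change (F.leftDerived i).map f = 0
  rw [← cancel_mono (P'.isoLeftDerivedObj F i).hom, Limits.zero_comp]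
  refine hnat.trans ?_
  have : (F.mapHomologicalComplex (ComplexShape.down ℕ) ⋙
      HomologicalComplex.homologyFunctor (ModuleCat.{u} R) _ i).map φ = 0 := hzero
  rw [this, Limits.comp_zero]

end Tor

/-! ### Symbolic powers and derivations -/

section SymbolicPower

variable {R : Type*} [CommRing R] {Q : Ideal R} {n : ℕ}

lemma mem_symbolicPower_iff {f : R} :
    f ∈ symbolicPower Q n ↔ ∀ P ∈ Q.minimalPrimes, ∃ s, s ∉ P ∧ s * f ∈ Q ^ n := by
  rw [symbolicPower, Submodule.mem_iInf]
  refine Subtype.forall.trans (forall₂_congr fun P hP => ?_)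
  have : P.IsPrime := hP.1.1
  rw [Ideal.mem_comap, IsLocalization.algebraMap_mem_map_algebraMap_iff P.primeCompl]
  rfl

lemma symbolicPower_zero : symbolicPower Q 0 = ⊤ := by
  rw [eq_top_iff]
  intro f _
  exact mem_symbolicPower_iff.mpr fun P hP =>
    ⟨1, hP.1.1.one_notMem, by simp⟩

lemma symbolicPower_succ_le : symbolicPower Q (n + 1) ≤ symbolicPower Q n := fun f hf =>
  mem_symbolicPower_iff.mpr fun P hP => by
    obtain ⟨s, hs, h⟩ := mem_symbolicPower_iff.mp hf P hP
    exact ⟨s, hs, Ideal.pow_le_pow_right n.le_succ h⟩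

lemma le_symbolicPower_one : Q ≤ symbolicPower Q 1 := fun f hf =>
  mem_symbolicPower_iff.mpr fun P hP =>
    ⟨1, hP.1.1.one_notMem, by simpa using hf⟩

lemma symbolicPower_succ_ne_top (hQ : Q ≠ ⊤) : symbolicPower Q (n + 1) ≠ ⊤ := by
  intro h
  obtain ⟨P, hP⟩ := Ideal.nonempty_minimalPrimes hQ
  obtain ⟨s, hs, h1⟩ := mem_symbolicPower_iff.mp ((Ideal.eq_top_iff_one _).mp h) P hP
  rw [mul_one] at h1
  exact hs (hP.1.2 (Ideal.pow_le_self n.succ_ne_zero h1))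

lemma isIdealFiltration_symbolicPower (hbot : Q ≠ ⊥) (htop : Q ≠ ⊤) :
    IsIdealFiltration fun n => symbolicPower Q n where
  zero_eq := symbolicPower_zero
  one_ne_bot h := hbot (le_bot_iff.mp (le_symbolicPower_one.trans h.le))
  one_ne_top := symbolicPower_succ_ne_top htop
  succ_le _ := symbolicPower_succ_le

variable {k : Type*} [CommRing k] [Algebra k R] (D : Derivation k R R)

lemma Derivation.apply_mem_pow_of_mem_pow_succ {f : R} (hf : f ∈ Q ^ (n + 1)) : D f ∈ Q ^ n := by
  induction n generalizing f with
  | zero => simp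
  | succ n ih =>
    rw [pow_succ] at hf
    refine Submodule.mul_induction_on hf (fun a ha b hb => ?_) fun a b ha hb => ?_
    · rw [D.leibniz, smul_eq_mul, smul_eq_mul]
      refine Ideal.add_mem _ (Ideal.mul_mem_right _ _ ha) ?_
      rw [pow_succ, mul_comm (Q ^ n)]
      exact Ideal.mul_mem_mul hb (ih ha)
    · rw [map_add]; exact Ideal.add_mem _ ha hb

lemma Derivation.apply_mem_pow_of_stable (hD : ∀ f ∈ Q, D f ∈ Q) {f : R} (hf : f ∈ Q ^ n) :
    D f ∈ Q ^ n := by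
  induction n generalizing f with
  | zero => simp
  | succ n ih =>
    rw [pow_succ] at hf ⊢
    refine Submodule.mul_induction_on hf (fun a ha b hb => ?_) fun a b ha hb => ?_
    · rw [D.leibniz, smul_eq_mul, smul_eq_mul]
      refine Ideal.add_mem _ (Ideal.mul_mem_mul ha (hD b hb)) ?_
      rw [mul_comm b]
      exact Ideal.mul_mem_mul (ih ha) hb
    · rw [map_add]; exact Ideal.add_mem _ ha hb

/-- The quotient rule with denominators cleared: if `s` witnesses membership of `f` at a prime, `s *
s` witnesses that of `D f`. -/
lemma Derivation.sq_mul_apply (s f : R) : s * s * D f = s * D (s * f) - D s * (s * f) := by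
  rw [D.leibniz, smul_eq_mul, smul_eq_mul]; ring

lemma Derivation.apply_mem_symbolicPower {f : R} (hf : f ∈ symbolicPower Q (n + 1)) :
    D f ∈ symbolicPower Q n :=
  mem_symbolicPower_iff.mpr fun P hP => by
    obtain ⟨s, hs, h⟩ := mem_symbolicPower_iff.mp hf P hP
    have := hP.1.1
    refine ⟨s * s, fun h' => (this.mem_or_mem h').elim hs hs, ?_⟩
    rw [D.sq_mul_apply]
    exact Ideal.sub_mem _ (Ideal.mul_mem_left _ _ (D.apply_mem_pow_of_mem_pow_succ h))
      (Ideal.mul_mem_left _ _ (Ideal.pow_le_pow_right n.le_succ h))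

lemma Derivation.apply_mem_symbolicPower_of_stable (hD : ∀ f ∈ Q, D f ∈ Q) {f : R}
    (hf : f ∈ symbolicPower Q n) : D f ∈ symbolicPower Q n :=
  mem_symbolicPower_iff.mpr fun P hP => by
    obtain ⟨s, hs, h⟩ := mem_symbolicPower_iff.mp hf P hP
    have := hP.1.1
    refine ⟨s * s, fun h' => (this.mem_or_mem h').elim hs hs, ?_⟩
    rw [D.sq_mul_apply]
    exact Ideal.sub_mem _ (Ideal.mul_mem_left _ _ (D.apply_mem_pow_of_stable hD h))
      (Ideal.mul_mem_left _ _ h)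

end SymbolicPower

/-! ### Symbolic powers of monomial ideals -/

section MonomialIdeal

variable {k : Type*} [Field k] {r : ℕ} {Q : Ideal (MvPolynomial (Fin r) k)}

lemma monomial_add_one (a b : Fin r →₀ ℕ) :
    monomial (a + b) (1 : k) = monomial a 1 * monomial b 1 := by
  rw [monomial_mul, mul_one]

lemma mem_of_forall_monomial_mem {f : MvPolynomial (Fin r) k}
    (h : ∀ a ∈ f.support, monomial a (1 : k) ∈ Q) : f ∈ Q := by
  rw [f.as_sum]
  refine Q.sum_mem fun a ha => ?_
  rw [← mul_one (coeff a f), ← C_mul_monomial]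
  exact Q.mul_mem_left _ (h a ha)

lemma IsMonomialIdeal.monomial_mem (hQ : IsMonomialIdeal Q) {f : MvPolynomial (Fin r) k}
    (hf : f ∈ Q) {a : Fin r →₀ ℕ} (ha : a ∈ f.support) : monomial a (1 : k) ∈ Q := by
  obtain ⟨E, rfl⟩ := hQ
  rw [mem_ideal_span_monomial_image] at hf ⊢
  intro b hb
  rw [Finset.mem_singleton.mp (support_monomial_subset hb)]
  exact hf a ha

lemma isMonomialIdeal_top : IsMonomialIdeal (⊤ : Ideal (MvPolynomial (Fin r) k)) := by
  refine ⟨{0}, ?_⟩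
  rw [Set.image_singleton, eq_comm, Ideal.span_singleton_eq_top]
  exact isUnit_one

lemma IsMonomialIdeal.mul {Q' : Ideal (MvPolynomial (Fin r) k)} (hQ : IsMonomialIdeal Q)
    (hQ' : IsMonomialIdeal Q') : IsMonomialIdeal (Q * Q') := by
  obtain ⟨E, rfl⟩ := hQ
  obtain ⟨E', rfl⟩ := hQ'
  refine ⟨Set.image2 (· + ·) E E', ?_⟩
  rw [Ideal.span_mul_span', ← Set.image2_mul, Set.image2_image_left, Set.image2_image_right,
    Set.image_image2]
  simp only [monomial_add_one]

lemma IsMonomialIdeal.pow (hQ : IsMonomialIdeal Q) (n : ℕ) : IsMonomialIdeal (Q ^ n) := by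
  induction n with
  | zero => simpa using isMonomialIdeal_top
  | succ n ih => rw [pow_succ]; exact ih.mul hQ

lemma modMonomial_mem_of_monomial_mem (hQ : ∀ f ∈ Q, ∀ a ∈ f.support, monomial a (1 : k) ∈ Q)
    {f : MvPolynomial (Fin r) k} (hf : f ∈ Q) (j : Fin r) :
    modMonomial f (Finsupp.single j 1) ∈ Q := by
  refine mem_of_forall_monomial_mem fun a ha => hQ f hf a ?_
  rw [mem_support_iff, coeff_modMonomial_single] at ha
  rw [mem_support_iff]
  exact fun h => ha (by rw [h, ite_self])

lemma divMonomial_mem_of_monomial_mem {Q' : Ideal (MvPolynomial (Fin r) k)} {j : Fin r}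
    (hQ : ∀ f ∈ Q, ∀ a ∈ f.support, monomial a (1 : k) ∈ Q)
    (h : ∀ a, monomial (Finsupp.single j 1 + a) (1 : k) ∈ Q → monomial a (1 : k) ∈ Q')
    {f : MvPolynomial (Fin r) k} (hf : f ∈ Q) : divMonomial f (Finsupp.single j 1) ∈ Q' := by
  refine mem_of_forall_monomial_mem fun a ha => h a (hQ f hf _ ?_)
  rwa [mem_support_iff, coeff_divMonomial, ← mem_support_iff] at ha

/-- A twisted Leibniz rule. Writing both factors as multiple of `X j` plus remainder, the product of
the remainders is free of `X j`, hence killed by `divX j`. -/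
lemma divX_mul (j : Fin r) (f g : MvPolynomial (Fin r) k) :
    divX j (f * g) = divX j f * g + modMonomial f (Finsupp.single j 1) * divX j g := by
  have hmod : divX j (modMonomial f (Finsupp.single j 1) *
      modMonomial g (Finsupp.single j 1)) = 0 := by
    classical
    ext a
    rw [coeff_divX, coeff_mul, coeff_zero]
    refine Finset.sum_eq_zero fun p hp => ?_
    have h := DFunLike.congr_fun (Finset.HasAntidiagonal.mem_antidiagonal.mp hp) j
    rw [Finsupp.add_apply, Finsupp.add_apply, Finsupp.single_eq_same] at h
    rw [coeff_modMonomial_single, coeff_modMonomial_single]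
    by_cases h1 : p.1 j = 0
    · rw [if_neg (by omega : ¬ p.2 j = 0), mul_zero]
    · rw [if_neg h1, zero_mul]
  have hf := divMonomial_add_modMonomial_single f j
  have hg := divMonomial_add_modMonomial_single g j
  rw [← divX_apply] at hf hg
  have hfg : f * g = X j * (divX j f * g + modMonomial f (Finsupp.single j 1) * divX j g) +
      modMonomial f (Finsupp.single j 1) * modMonomial g (Finsupp.single j 1) := by
    linear_combination -(g * hf) - modMonomial f (Finsupp.single j 1) * hg
  rw [hfg, map_add, hmod, add_zero, divX_apply, X_mul_divMonomial]

lemma IsMonomialIdeal.divX_mem_pow (hQ : IsMonomialIdeal Q) {n : ℕ} {f : MvPolynomial (Fin r) k}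
    (hf : f ∈ Q ^ (n + 1)) (j : Fin r) : divX j f ∈ Q ^ n := by
  induction n generalizing f with
  | zero => simp
  | succ n ih =>
    rw [pow_succ] at hf
    refine Submodule.mul_induction_on hf (fun a ha b hb => ?_) fun a b ha hb => ?_
    · rw [divX_mul]
      refine Ideal.add_mem _ ?_ (Ideal.mul_mem_right _ _
        (modMonomial_mem_of_monomial_mem (fun f hf a => (hQ.pow _).monomial_mem hf) ha j))
      rw [pow_succ]
      exact Ideal.mul_mem_mul (ih ha) hb
    · rw [map_add]; exact Ideal.add_mem _ ha hb

/-- The substitution of `0` for the variables in `T`. -/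
def killVars (k : Type*) [Field k] {r : ℕ} (T : Set (Fin r)) :
    MvPolynomial (Fin r) k →ₐ[k] MvPolynomial (Fin r) k :=
  haveI := Classical.decPred (· ∈ T)
  aeval fun j => if j ∈ T then 0 else X j

lemma killVars_X_of_mem {T : Set (Fin r)} {j : Fin r} (hj : j ∈ T) :
    killVars k T (X j) = 0 := by simp [killVars, hj]

lemma killVars_X_of_notMem {T : Set (Fin r)} {j : Fin r} (hj : j ∉ T) :
    killVars k T (X j) = X j := by simp [killVars, hj]

lemma sub_killVars_mem (T : Set (Fin r)) (f : MvPolynomial (Fin r) k) :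
    f - killVars k T f ∈ Ideal.span (X '' T : Set (MvPolynomial (Fin r) k)) := by
  induction f using MvPolynomial.induction_on with
  | C a => simp [killVars]
  | add f g hf hg =>
    rw [map_add, add_sub_add_comm]
    exact Ideal.add_mem _ hf hg
  | mul_X f j hf =>
    rw [map_mul]
    by_cases hj : j ∈ T
    · rw [killVars_X_of_mem hj, mul_zero, sub_zero]
      exact Ideal.mul_mem_left _ _ (Ideal.subset_span ⟨j, hj, rfl⟩)
    · rw [killVars_X_of_notMem hj, ← sub_mul]
      exact Ideal.mul_mem_right _ _ hf

lemma killVars_mem_supported (T : Set (Fin r)) (f : MvPolynomial (Fin r) k) :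
    killVars k T f ∈ supported k Tᶜ := by
  induction f using MvPolynomial.induction_on with
  | C a =>
    rw [← algebraMap_eq, AlgHom.commutes]
    exact Subalgebra.algebraMap_mem _ _
  | add f g hf hg => rw [map_add]; exact add_mem hf hg
  | mul_X f j hf =>
    rw [map_mul]
    refine mul_mem hf ?_
    by_cases hj : j ∈ T
    · rw [killVars_X_of_mem hj]; exact zero_mem _
    · rw [killVars_X_of_notMem hj]
      exact X_mem_supported.mpr hj

lemma span_X_image_eq_ker (T : Set (Fin r)) :
    Ideal.span (X '' T : Set (MvPolynomial (Fin r) k)) = RingHom.ker (killVars k T) := by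
  refine le_antisymm (Ideal.span_le.mpr ?_) fun f hf => ?_
  · rintro _ ⟨j, hj, rfl⟩
    exact killVars_X_of_mem hj
  · have := sub_killVars_mem T f
    rwa [(RingHom.mem_ker).mp hf, sub_zero] at this

lemma isPrime_span_X_image (T : Set (Fin r)) :
    (Ideal.span (X '' T : Set (MvPolynomial (Fin r) k))).IsPrime := by
  rw [span_X_image_eq_ker]
  exact RingHom.ker_isPrime _

lemma monomial_mem_span_X_image_iff {T : Set (Fin r)} {e : Fin r →₀ ℕ} :
    monomial e (1 : k) ∈ Ideal.span (X '' T : Set (MvPolynomial (Fin r) k)) ↔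
      ∃ i ∈ T, e i ≠ 0 := by
  classical
  rw [mem_ideal_span_X_image, support_monomial, if_neg one_ne_zero]
  simp

/-- Minimal primes of a monomial ideal are generated by variables. -/
lemma IsMonomialIdeal.minimalPrime_eq (hQ : IsMonomialIdeal Q)
    {P : Ideal (MvPolynomial (Fin r) k)} (hP : P ∈ Q.minimalPrimes) :
    P = Ideal.span (X '' {j | X j ∈ P}) := by
  have hprime := hP.1.1
  have hle : Ideal.span (X '' {j | X j ∈ P}) ≤ P := by
    rw [Ideal.span_le]
    rintro _ ⟨j, hj, rfl⟩
    exact hj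
  refine le_antisymm (hP.2 ⟨isPrime_span_X_image _, ?_⟩ hle) hle
  obtain ⟨E, rfl⟩ := hQ
  rw [Ideal.span_le]
  rintro _ ⟨e, he, rfl⟩
  have heP : monomial e (1 : k) ∈ P := hP.1.2 (Ideal.subset_span ⟨e, he, rfl⟩)
  rw [monomial_eq, C_1, one_mul, Finsupp.prod, hprime.prod_mem_iff] at heP
  obtain ⟨i, hi, h⟩ := heP
  exact monomial_mem_span_X_image_iff.mpr
    ⟨i, hprime.mem_of_pow_mem _ h, Finsupp.mem_support_iff.mp hi⟩

/-- The contraction to `k[x]` of the extension of `Q` to the localization at the monomials that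
are not in the prime ideal `P`. -/
def monomialContraction (Q P : Ideal (MvPolynomial (Fin r) k)) [P.IsPrime] :
    Ideal (MvPolynomial (Fin r) k) where
  carrier := {g | ∃ b, monomial b (1 : k) ∉ P ∧ monomial b 1 * g ∈ Q}
  zero_mem' := ⟨0, fun h => Ideal.IsPrime.one_notMem ‹_› h, by simp⟩
  add_mem' := by
    rintro f g ⟨b, hb, hf⟩ ⟨c, hc, hg⟩
    refine ⟨b + c, fun h => ?_, ?_⟩
    · rw [monomial_add_one] at h
      exact (Ideal.IsPrime.mem_or_mem ‹_› h).elim hb hc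
    · have h : monomial (b + c) (1 : k) * (f + g) =
          monomial c 1 * (monomial b 1 * f) + monomial b 1 * (monomial c 1 * g) := by
        rw [monomial_add_one]; ring
      rw [h]
      exact Q.add_mem (Q.mul_mem_left _ hf) (Q.mul_mem_left _ hg)
  smul_mem' := by
    rintro c g ⟨b, hb, hg⟩
    refine ⟨b, hb, ?_⟩
    rw [smul_eq_mul, mul_left_comm]
    exact Q.mul_mem_left _ hg

lemma mem_monomialContraction {P : Ideal (MvPolynomial (Fin r) k)} [P.IsPrime]
    {g : MvPolynomial (Fin r) k} :
    g ∈ monomialContraction Q P ↔ ∃ b, monomial b (1 : k) ∉ P ∧ monomial b 1 * g ∈ Q := Iff.rfl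

lemma IsMonomialIdeal.minimalPrime_le_radical (hQ : IsMonomialIdeal Q) (n : ℕ)
    {P : Ideal (MvPolynomial (Fin r) k)} [P.IsPrime] (hP : P ∈ Q.minimalPrimes) :
    P ≤ (monomialContraction (Q ^ n) P).radical := by
  have hPeq := hQ.minimalPrime_eq hP
  refine hPeq.le.trans (Ideal.span_le.mpr ?_)
  rintro _ ⟨j, hj, rfl⟩
  set T : Set (Fin r) := {j | X j ∈ P} with hT
  have hle : Ideal.span (X '' (T \ {j})) ≤ P := by
    rw [Ideal.span_le]
    rintro _ ⟨i, hi, rfl⟩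
    exact hi.1
  -- By minimality of `P`, some monomial of `Q` involves `X j` but no other variable of `P`; its
  -- cofactor away from `X j` is the monomial denominator.
  have hnle : ¬ Q ≤ Ideal.span (X '' (T \ {j})) := fun h => by
    have h1 : X j ∈ Ideal.span (X '' (T \ {j}) : Set (MvPolynomial (Fin r) k)) :=
      hP.2 ⟨isPrime_span_X_image _, h⟩ hle hj
    rw [X, monomial_mem_span_X_image_iff] at h1
    obtain ⟨i, hi, h⟩ := h1
    exact h (Finsupp.single_eq_of_ne hi.2)
  obtain ⟨E, hE⟩ := id hQ
  obtain ⟨e, he, heT⟩ : ∃ e, monomial e (1 : k) ∈ Q ∧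
      monomial e (1 : k) ∉ Ideal.span (X '' (T \ {j}) : Set (MvPolynomial (Fin r) k)) := by
    by_contra! hcon
    refine hnle ?_
    rw [hE, Ideal.span_le]
    rintro _ ⟨e, he, rfl⟩
    exact hcon e (hE ▸ Ideal.subset_span ⟨e, he, rfl⟩)
  have heP : monomial (e.erase j) (1 : k) ∉ P := by
    rw [hPeq, monomial_mem_span_X_image_iff]
    rintro ⟨i, hi, h⟩
    have hij : i ≠ j := by rintro rfl; exact h Finsupp.erase_same
    rw [Finsupp.erase_ne hij] at h
    exact heT (monomial_mem_span_X_image_iff.mpr ⟨i, ⟨hi, hij⟩, h⟩)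
  refine ⟨e j * n, mem_monomialContraction.mpr ⟨n • e.erase j, ?_, ?_⟩⟩
  · rw [show monomial (n • e.erase j) (1 : k) = monomial (e.erase j) 1 ^ n by
      rw [monomial_pow, one_pow]]
    exact fun h => heP (Ideal.IsPrime.mem_of_pow_mem ‹_› n h)
  · have : monomial (n • e.erase j) (1 : k) * X j ^ (e j * n) = monomial e 1 ^ n := by
      rw [X_pow_eq_monomial, ← monomial_add_one, monomial_pow, one_pow, mul_comm (e j),
        ← smul_eq_mul, ← Finsupp.smul_single, ← smul_add, add_comm, Finsupp.single_add_erase]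
    rw [this]
    exact Ideal.pow_mem_pow he n

/-- An arbitrary witness `s` is replaced by a polynomial `u` in the variables outside `P`, at the
cost of a monomial factor. The monomials of `f` can then be separated. -/
lemma IsMonomialIdeal.exists_monomial_mul_mem (hQ : IsMonomialIdeal Q) {n : ℕ}
    {P : Ideal (MvPolynomial (Fin r) k)} (hP : P ∈ Q.minimalPrimes)
    {s f : MvPolynomial (Fin r) k} (hs : s ∉ P) (hsf : s * f ∈ Q ^ n)
    {a : Fin r →₀ ℕ} (ha : a ∈ f.support) :
    ∃ b, monomial b (1 : k) ∉ P ∧ monomial (b + a) (1 : k) ∈ Q ^ n := by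
  classical
  have := hP.1.1
  set T : Set (Fin r) := {j | X j ∈ P} with hT
  have hPeq : P = Ideal.span (X '' T) := hQ.minimalPrime_eq hP
  have hd : killVars k T s - s ∈ P := by
    rw [hPeq, ← neg_mem_iff, neg_sub]
    exact sub_killVars_mem T s
  obtain ⟨M, c, hc, hcM⟩ := hQ.minimalPrime_le_radical n hP hd
  set u := killVars k T s ^ M with hu
  have hu0 : u ≠ 0 := pow_ne_zero _ fun h => hs (by
    rw [h, zero_sub, neg_mem_iff] at hd; exact hd)
  have huT : u ∈ supported k Tᶜ := pow_mem (killVars_mem_supported T s) M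
  have huf : monomial c 1 * (u * f) ∈ Q ^ n := by
    -- With `t = killVars s`, `t ^ M` is `(t - s) ^ M` plus a multiple of `s`; `x^c` handles the
    -- first term and `hsf` the second.
    obtain ⟨v, hv⟩ := sub_dvd_pow_sub_pow (killVars k T s) (killVars k T s - s) M
    rw [sub_sub_cancel] at hv
    have : monomial c 1 * (u * f) =
        monomial c 1 * (killVars k T s - s) ^ M * f + monomial c 1 * v * (s * f) := by
      rw [hu, eq_add_of_sub_eq hv]; ring
    rw [this]
    exact Ideal.add_mem _ (Ideal.mul_mem_right _ _ hcM) (Ideal.mul_mem_left _ _ hsf)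
  have hub : ∀ b ∈ u.support, monomial (c + b) (1 : k) ∉ P := by
    intro b hb h
    rw [monomial_add_one] at h
    refine (this.mem_or_mem h).elim hc fun h => ?_
    rw [hPeq, monomial_mem_span_X_image_iff] at h
    obtain ⟨i, hi, h⟩ := h
    exact mem_supported.mp huT
      ((mem_vars_iff_mem_support i).mpr ⟨b, hb, Finsupp.mem_support_iff.mpr h⟩) hi
  suffices monomial a 1 ∈ monomialContraction (Q ^ n) P by
    obtain ⟨b, hb, hba⟩ := this
    exact ⟨b, hb, by rwa [monomial_add_one]⟩
  by_contra hbad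
  -- The part of `f` made of the monomials that violate the claim.
  set g : MvPolynomial (Fin r) k := ∑ d ∈ f.support with
    monomial d 1 ∉ monomialContraction (Q ^ n) P, monomial d (coeff d f) with hg
  have hcoeff : ∀ d, coeff d g =
      if monomial d 1 ∉ monomialContraction (Q ^ n) P then coeff d f else 0 := by
    intro d
    simp only [hg, coeff_sum, coeff_monomial, Finset.sum_ite_eq', Finset.mem_filter,
      mem_support_iff]
    by_cases h : coeff d f = 0 <;> simp [h]
  have hfg : f - g ∈ monomialContraction (Q ^ n) P := by
    refine mem_of_forall_monomial_mem fun d hd => ?_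
    by_contra h
    rw [mem_support_iff, coeff_sub, hcoeff, if_pos h, sub_self] at hd
    exact hd rfl
  obtain ⟨b, hb, hbg⟩ : monomial c 1 * (u * g) ∈ monomialContraction (Q ^ n) P := by
    have : monomial c 1 * (u * g) = monomial c 1 * (u * f) - monomial c 1 * u * (f - g) := by ring
    rw [this]
    exact Ideal.sub_mem _
      (mem_monomialContraction.mpr ⟨0, Ideal.IsPrime.one_notMem ‹_›, Ideal.mul_mem_left _ _ huf⟩)
      (Ideal.mul_mem_left _ _ hfg)
  -- Any monomial of `u * g` is one of `u` times one of `g`, and lies in the contraction; since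
  -- monomials of `u` avoid `P`, the factor from `g` would lie there too.
  have hug : u * g = 0 := by
    by_contra h
    obtain ⟨p, hp⟩ := support_nonempty.mpr h
    obtain ⟨e, he, d, hd, rfl⟩ := Finset.mem_add.mp (support_mul u g hp)
    rw [mem_support_iff, hcoeff] at hd
    refine (ite_ne_right_iff.mp hd).1 (mem_monomialContraction.mpr ⟨b + (c + e), fun h => ?_, ?_⟩)
    · rw [monomial_add_one] at h
      exact (this.mem_or_mem h).elim hb (hub e he)
    · rw [← monomial_add_one, add_assoc, add_assoc]
      refine (hQ.pow n).monomial_mem hbg ?_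
      rw [← mul_assoc, ← monomial_add_one, mem_support_iff, ← add_assoc, coeff_monomial_mul,
        one_mul]
      exact mem_support_iff.mp hp
  have hg0 := (mul_eq_zero.mp hug).resolve_left hu0
  have := hcoeff a
  rw [hg0, if_pos hbad, coeff_zero] at this
  exact mem_support_iff.mp ha this.symm

lemma IsMonomialIdeal.monomial_mem_symbolicPower (hQ : IsMonomialIdeal Q) {n : ℕ}
    {f : MvPolynomial (Fin r) k} (hf : f ∈ symbolicPower Q n) {a : Fin r →₀ ℕ}
    (ha : a ∈ f.support) : monomial a (1 : k) ∈ symbolicPower Q n :=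
  mem_symbolicPower_iff.mpr fun P hP => by
    obtain ⟨s, hs, h⟩ := mem_symbolicPower_iff.mp hf P hP
    obtain ⟨b, hb, hba⟩ := hQ.exists_monomial_mul_mem hP hs h ha
    exact ⟨monomial b 1, hb, by rwa [← monomial_add_one]⟩

lemma IsMonomialIdeal.monomial_mem_symbolicPower_of_single_add (hQ : IsMonomialIdeal Q) {n : ℕ}
    {j : Fin r} {a : Fin r →₀ ℕ}
    (ha : monomial (Finsupp.single j 1 + a) (1 : k) ∈ symbolicPower Q (n + 1)) :
    monomial a (1 : k) ∈ symbolicPower Q n :=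
  mem_symbolicPower_iff.mpr fun P hP => by
    obtain ⟨s, hs, h⟩ := mem_symbolicPower_iff.mp ha P hP
    obtain ⟨b, hb, hba⟩ := hQ.exists_monomial_mul_mem hP hs h
      (a := Finsupp.single j 1 + a) (by simp)
    refine ⟨monomial b 1, hb, ?_⟩
    have := hQ.divX_mem_pow hba j
    rwa [add_left_comm, monomial_add_one, divX_apply, divMonomial_monomial_mul,
      monomial_add_one] at this

end MonomialIdeal

/-! ### The Koszul criterion for ideals -/

section TorVanishing

variable {k : Type*} [Field k] {r : ℕ} {Q Q' : Ideal (MvPolynomial (Fin r) k)}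

lemma isTorVanishingInclusion_of_koszul (hle : Q ≤ Q')
    (h : ∀ z : Finset (Fin r) → MvPolynomial (Fin r) k, (∀ S, z S ∈ Q) →
      koszulD (X : Fin r → MvPolynomial (Fin r) k) z = 0 →
      ∃ w : Finset (Fin r) → MvPolynomial (Fin r) k, (∀ S, w S ∈ Q') ∧
        koszulD (X : Fin r → MvPolynomial (Fin r) k) w = z) :
    IsTorVanishingInclusion hle := by
  intro i
  refine tor_map_eq_zero_of_koszul koszulAcyclic_mvPolynomial _ (fun z hz => ?_) i
  obtain ⟨w, hw, hwz⟩ := h (fun S => Q.subtype (z S)) (fun S => (z S).2) (by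
    rw [koszulD_comp]
    exact funext fun S => congrArg Q.subtype (congrFun hz S))
  refine ⟨fun S => (⟨w S, hw S⟩ : Q'), funext fun S => Subtype.ext ?_⟩
  have h1 := congrFun (koszulD_comp (X : Fin r → MvPolynomial (Fin r) k) Q'.subtype
    (fun S => (⟨w S, hw S⟩ : Q'))) S
  exact h1.symm.trans (congrFun hwz S)

lemma constantCoeff_eq_zero_of_mem (hQ : Q ≠ ⊤)
    {f : MvPolynomial (Fin r) k} (h : C (constantCoeff f) ∈ Q) : constantCoeff f = 0 := by
  by_contra h0
  exact hQ (Q.eq_top_of_isUnit_mem h ((IsUnit.mk0 _ h0).map C))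

end TorVanishing

end

theorem proposition5p5 {k : Type*} [Field k] {r : ℕ} (I : Ideal (MvPolynomial (Fin r) k))
    (hI_bot : I ≠ ⊥) (hI_top : I ≠ ⊤) :
    -- homogeneous ideals in characteristic zero
    (CharZero k →
      letI := MvPolynomial.gradedAlgebra (σ := Fin r) (R := k)
      I.IsHomogeneous (MvPolynomial.homogeneousSubmodule (Fin r) k) →
      (∀ n : ℕ, 1 ≤ n → ∀ S : Set (MvPolynomial (Fin r) k),
        Ideal.span S = symbolicPower I n → partialIdeal S ≤ symbolicPower I (n - 1)) ∧
      IsTorVanishingFiltration (fun n => symbolicPower I n)) ∧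
    -- monomial ideals in arbitrary characteristic
    (IsMonomialIdeal I →
      (∀ n : ℕ, 1 ≤ n → partialStarIdeal (symbolicPower I n) ≤ symbolicPower I (n - 1)) ∧
      IsTorVanishingFiltration (fun n => symbolicPower I n)) := by
  refine ⟨fun hchar hhom => ⟨fun n hn S hS => ?_, ?_⟩, fun hmon => ⟨fun n hn => ?_, ?_⟩⟩
  · obtain ⟨n, rfl⟩ := Nat.exists_eq_add_of_le' hn
    refine Ideal.span_le.mpr ?_
    rintro _ ⟨f, hf, i, rfl⟩
    exact (MvPolynomial.pderiv i).apply_mem_symbolicPower (hS ▸ Ideal.subset_span hf)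
  · refine { isIdealFiltration_symbolicPower hI_bot hI_top with torVanishing := fun n => ?_ }
    -- Homogeneity passes from `I` to its symbolic powers through stability under the Euler
    -- derivation.
    have hEuler : ∀ f ∈ I, eulerDerivation (Fin r) k f ∈ I := fun f hf =>
      eulerDerivation_mem_of_homogeneousComponent_mem fun n =>
        MvPolynomial.homogeneousComponent_mem_of_mem hhom hf n
    have hcomp : ∀ f ∈ symbolicPower I (n + 1), ∀ m,
        MvPolynomial.homogeneousComponent m f ∈ symbolicPower I (n + 1) := fun f hf m =>
      homogeneousComponent_mem_of_eulerDerivation_mem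
        (fun f hf => Derivation.apply_mem_symbolicPower_of_stable _ hEuler hf) hf m
    refine isTorVanishingInclusion_of_koszul _ fun z hz hcyc =>
      exists_koszulD_eq_of_pderiv hcomp
        (fun f hf j => (MvPolynomial.pderiv j).apply_mem_symbolicPower hf) z hz hcyc
        (constantCoeff_eq_zero_of_mem (symbolicPower_succ_ne_top (n := n) hI_top) ?_)
    have := hcomp _ (hz ∅) 0
    rwa [MvPolynomial.homogeneousComponent_zero] at this
  · obtain ⟨n, rfl⟩ := Nat.exists_eq_add_of_le' hn
    refine Ideal.span_le.mpr ?_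
    rintro _ ⟨d, hd, i, hi, rfl⟩
    refine hmon.monomial_mem_symbolicPower_of_single_add (j := i) ?_
    rw [add_tsub_cancel_of_le]
    · exact hd.prop
    · rw [Finsupp.single_le_iff]
      exact Nat.one_le_iff_ne_zero.mpr (Finsupp.mem_support_iff.mp hi)
  · refine { isIdealFiltration_symbolicPower hI_bot hI_top with torVanishing := fun n => ?_ }
    have hterm : ∀ f ∈ symbolicPower I (n + 1), ∀ a ∈ f.support,
        MvPolynomial.monomial a (1 : k) ∈ symbolicPower I (n + 1) := fun f hf a ha =>
      hmon.monomial_mem_symbolicPower hf ha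
    refine isTorVanishingInclusion_of_koszul _ fun z hz hcyc =>
      exists_koszulD_eq_of_divX (fun f hf j => modMonomial_mem_of_monomial_mem hterm hf j)
        (fun f hf j => divMonomial_mem_of_monomial_mem hterm
          (fun a ha => hmon.monomial_mem_symbolicPower_of_single_add ha) hf) z hz hcyc ?_
    -- A nonzero constant term of `z ∅` would put the monomial `1` in a proper ideal.
    by_contra h0
    refine symbolicPower_succ_ne_top (n := n) hI_top ((Ideal.eq_top_iff_one _).mpr ?_)
    exact hterm _ (hz ∅) 0 (MvPolynomial.mem_support_iff.mpr h0)
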